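/- For $n\in\mathbb N$ let $$S^5(n)=\{(x_1,\dots,x_5)\in\mathbb N^5 : 0\le x_1<x_2<x_3<x_4<x_5\le n\},$$ and for $A\subseteq S^5(n)$ let $\pi_i(A)$ be the multiset of the $x_i$-coordinates of the points of $A$. A multiset $M$ of integers is called *sparse* if it has no duplicates and $|a-b|\ge 2$ for all distinct $a,b\in M$; it is called *2-sparse* if it has no duplicates and there are no distinct $a,b\in M$ with $\lfloor a/2\rfloor=\lfloor b/2\rfloor$. Let $2\le l\le n-3$. Then the number of $l$-element subsets $A\subseteq S^5(n)$ such that $\pi_3(A)$ is sparse is at least the number of $l$-element subsets $A\subseteq S^5(n)$ such that $\pi_1(A)$ is 2-sparse. More precisely, if $2l\le n-2$, then there are strictly more subsets of the first kind than of the second kind, and if $2l>n-2$, then there are no subsets of either kind. -/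

import Mathlib

/-- The discrete order simplex `S^N(n)`: all `N`-tuples of natural numbers with
`0 ≤ x₁ < x₂ < ⋯ < x_N ≤ n`. The coordinate `x_{i+1}` is `x i`, for `i : Fin N`. -/
def orderSimplex (N n : ℕ) : Finset (Fin N → ℕ) :=
  (Fintype.piFinset fun _ : Fin N => Finset.range (n + 1)).filter
    fun x => ∀ i j : Fin N, i < j → x i < x j

theorem mem_orderSimplex {N n : ℕ} {x : Fin N → ℕ} :
    x ∈ orderSimplex N n ↔ StrictMono x ∧ ∀ i, x i ≤ n := by
  simp only [orderSimplex, Finset.mem_filter, Fintype.mem_piFinset, Finset.mem_range,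
    Nat.lt_succ_iff]
  exact ⟨fun h => ⟨fun i j hij => h.2 i j hij, h.1⟩, fun h => ⟨h.2, fun i j hij => h.1 hij⟩⟩

/-- The multiset of values of the coordinate with index `i` on the points of `A`. -/
def coordValues {N : ℕ} (i : Fin N) (A : Finset (Fin N → ℕ)) : Multiset ℤ :=
  A.val.map fun x => (x i : ℤ)

/-- A multiset of integers is sparse if it has no duplicates and `|a - b| ≥ 2` for all
distinct members `a`, `b`. -/
def IsSparse (M : Multiset ℤ) : Prop :=
  M.Nodup ∧ ∀ a ∈ M, ∀ b ∈ M, a ≠ b → 2 ≤ |a - b|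

/-- A multiset of integers is 2-sparse if it has no duplicates and no two distinct members
`a`, `b` satisfy `⌊a/2⌋ = ⌊b/2⌋`. (Integer division by `2` rounds down.) -/
def IsTwoSparse (M : Multiset ℤ) : Prop :=
  M.Nodup ∧ ¬ ∃ a ∈ M, ∃ b ∈ M, a ≠ b ∧ a / 2 = b / 2

open Classical in
/-- The number of `l`-element subsets of `S^N(n)` whose multiset of values of the coordinate
with index `i` has the property `P`. -/
noncomputable def countSubsets (N n l : ℕ) (i : Fin N) (P : Multiset ℤ → Prop) : ℕ :=
  (((orderSimplex N n).powersetCard l).filter fun A => P (coordValues i A)).card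

/-! Each count becomes a weighted count of sets of coordinate values, a set weighing the product of
the sizes of its fibres. For the third coordinate the fibre over `k` has C(k,2)·C(n-k,2) points. For
the first it has C(n-k,4), which depends only on n-k. Removing the block {0,1} therefore turns n
into n-2 and gives the exact recurrence T(n,l+1) = T(n-2,l+1) + f(n)·T(n-2,l), with f(n) = C(n,4) +
C(n-1,4).

It suffices that the sparse count S satisfies this recurrence with ≥ (`sparseTotal_add_two_ge`).
Here the weights themselves change with n, so the weights w for n and w' for n-2 are compared on
initial segments: `sparseSum_comparison` carries a correction term whose coefficient p(k) is the sum
of w-w' below k. Its induction needs only p(k+3)·w'(k+1) ≤ p(k+2)·w(k+3), a consequence of the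
polynomial identity `weightGap_mul_identity`. At the end of the segment p equals f(n)
(`weightGap_last`).

Strictness enters at l = 2, from the strict case k = 1 of that inequality, and passes to larger l
through the recurrence because f(n) > 0. -/

/-! ### Weighted sums over sparse sets -/

/-- The weighted number of `l`-element subsets of `{0, …, k - 1}` without two consecutive
members, where a subset has the product of the weights of its members as its weight. -/
def sparseSum (w : ℕ → ℕ) : ℕ → ℕ → ℕ
  | _, 0 => 1
  | 0, _ + 1 => 0
  | 1, l + 1 => if l = 0 then w 0 else 0
  | k + 2, l + 1 => sparseSum w (k + 1) (l + 1) + w (k + 1) * sparseSum w k l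

theorem sparseSum_zero_right (w : ℕ → ℕ) (k : ℕ) : sparseSum w k 0 = 1 := by
  cases k <;> rfl

theorem sparseSum_add_two (w : ℕ → ℕ) (k l : ℕ) :
    sparseSum w (k + 2) (l + 1) = sparseSum w (k + 1) (l + 1) + w (k + 1) * sparseSum w k l :=
  rfl

theorem sparseSum_succ_of_eq_zero {w : ℕ → ℕ} {k : ℕ} (h : w k = 0) (l : ℕ) :
    sparseSum w (k + 1) l = sparseSum w k l := by
  rcases l with - | l
  · simp only [sparseSum_zero_right]
  rcases k with - | k
  · simp [sparseSum, h]
  · rw [sparseSum_add_two, h, zero_mul, add_zero]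

/-- Comparison of the sums for two weights `w` and `w'`. The function `p` collects the
differences of the weights. -/
theorem sparseSum_comparison {w w' p : ℕ → ℕ} {N : ℕ}
    (hw0 : w 0 = 0) (hw1 : w 1 = 0) (hw0' : w' 0 = 0) (hw1' : w' 1 = 0) (hp : p 2 = 0)
    (hstep : ∀ k ≤ N, w (k + 2) + p (k + 2) = w' (k + 2) + p (k + 3))
    (hmul : ∀ k, k + 1 ≤ N → p (k + 3) * w' (k + 1) ≤ p (k + 2) * w (k + 3)) :
    ∀ k ≤ N + 1, ∀ l,
      sparseSum w' (k + 2) (l + 1) + p (k + 2) * sparseSum w' k l ≤ sparseSum w (k + 2) (l + 1)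
  | 0, _, l => by
    simp [sparseSum, hw0, hw1, hw0', hw1', hp]
  | 1, _, l => by
    have h := hstep 0 (Nat.zero_le _)
    rcases l with - | l
    · simp only [sparseSum, hw0, hw1, hw0', hw1']
      simp only [zero_add] at h ⊢
      simp
      omega
    · simp [sparseSum, hw0, hw1, hw0', hw1']
  | k + 2, hk, l => by
    have h1 := sparseSum_comparison hw0 hw1 hw0' hw1' hp hstep hmul (k + 1) (by omega) l
    have hs := hstep (k + 1) (by omega)
    have hm := hmul k (by omega)
    rcases l with - | l
    · simp only [sparseSum_add_two w (k + 2), sparseSum_add_two w' (k + 2), sparseSum_zero_right,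
        mul_one] at h1 ⊢
      simp only [add_assoc, Nat.reduceAdd] at *
      omega
    · have h2 := sparseSum_comparison hw0 hw1 hw0' hw1' hp hstep hmul k (by omega) l
      rw [sparseSum_add_two w (k + 2), sparseSum_add_two w' (k + 2)]
      have e := sparseSum_add_two w' k l
      simp only [add_assoc, Nat.reduceAdd] at *
      rw [e] at h2 ⊢
      -- After both sums are expanded at their top element and `hs` is used, what remains is `hm`
      -- times the sum of `w'` over `l`-sets below `k`.
      have h3 := Nat.mul_le_mul_right (sparseSum w' k l) hm
      have h4 := Nat.mul_le_mul_left (w (k + 3)) h2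
      zify at *
      linear_combination h1 + h3 + h4 -
        (sparseSum w' (k + 1) (l + 1) + w' (k + 1) * sparseSum w' k l : ℤ) * hs

/-- The comparison is strict for sets with two members, from the fourth place on. -/
theorem sparseSum_comparison_lt {w w' p : ℕ → ℕ} {N : ℕ}
    (hw0 : w 0 = 0) (hw1 : w 1 = 0) (hw0' : w' 0 = 0) (hw1' : w' 1 = 0) (hp : p 2 = 0)
    (hstep : ∀ k ≤ N, w (k + 2) + p (k + 2) = w' (k + 2) + p (k + 3))
    (hmul : ∀ k, k + 1 ≤ N → p (k + 3) * w' (k + 1) ≤ p (k + 2) * w (k + 3))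
    (hlt : p 4 * w' 2 < p 3 * w 4) : ∀ k, k + 3 ≤ N + 1 →
    sparseSum w' (k + 5) 2 + p (k + 5) * sparseSum w' (k + 3) 1 < sparseSum w (k + 5) 2 := by
  -- The premise adds the comparison one place earlier to the product inequality; strictness of
  -- either one suffices. `hlt` supplies it at the start, the induction hypothesis afterwards.
  have step : ∀ k, k + 3 ≤ N + 1 →
      sparseSum w' (k + 4) 2 + p (k + 4) * sparseSum w' (k + 2) 1 +
        p (k + 4) * w' (k + 2) < sparseSum w (k + 4) 2 + p (k + 3) * w (k + 4) →
      sparseSum w' (k + 5) 2 + p (k + 5) * sparseSum w' (k + 3) 1 < sparseSum w (k + 5) 2 := by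
    intro k hk h1
    have h2 := sparseSum_comparison hw0 hw1 hw0' hw1' hp hstep hmul (k + 1) (by omega) 0
    have hs := hstep (k + 2) (by omega)
    have e : sparseSum w' (k + 3) 1 = sparseSum w' (k + 2) 1 + w' (k + 2) := by
      rw [sparseSum_add_two w' (k + 1) 0, sparseSum_zero_right, mul_one]
    have h4 := Nat.mul_le_mul_left (w (k + 4)) h2
    have hs' := congrArg (· * sparseSum w' (k + 3) 1) hs
    have e' := congrArg (p (k + 4) * ·) e
    simp only [add_assoc, Nat.reduceAdd, sparseSum_zero_right, mul_one, mul_add, add_mul,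
      zero_add] at *
    rw [sparseSum_add_two w (k + 3), sparseSum_add_two w' (k + 3)]
    rw [mul_comm (w (k + 4)) (p _)] at h4
    simp only [add_assoc, Nat.reduceAdd] at *
    omega
  intro k
  induction k with
  | zero =>
    exact fun hk => step 0 hk (add_lt_add_of_le_of_lt
      (sparseSum_comparison hw0 hw1 hw0' hw1' hp hstep hmul 2 (by omega) 1) hlt)
  | succ k ih =>
    exact fun hk => step (k + 1) hk
      (add_lt_add_of_lt_of_le (ih (by omega)) (hmul (k + 2) (by omega)))

/-- Only 2, …, k-1 can carry weight, and l+1 members with gaps at least 2 need 2l+1 consecutive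
places. -/
theorem sparseSum_eq_zero {w : ℕ → ℕ} (hw0 : w 0 = 0) (hw1 : w 1 = 0) :
    ∀ k l, k < 2 * l + 3 → sparseSum w k (l + 1) = 0
  | 0, _, _ => rfl
  | 1, l, _ => by simp [sparseSum, hw0]
  | k + 2, l, h => by
    rw [sparseSum_add_two, sparseSum_eq_zero hw0 hw1 (k + 1) l (by omega), zero_add]
    rcases l with - | l
    · obtain rfl : k = 0 := by omega
      rw [hw1, zero_mul]
    · rw [sparseSum_eq_zero hw0 hw1 k l (by omega), mul_zero]

/-! ### The weights and their accumulated differences -/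

/-- The number of points of `S⁵(n)` with middle coordinate `k`. -/
def middleWeight (n k : ℕ) : ℕ := k.choose 2 * (n - k).choose 2

/-- The number of points of `S⁵(n)` with first coordinate `0` or `1`. -/
def firstPairWeight (n : ℕ) : ℕ := n.choose 4 + (n - 1).choose 4

/-- The accumulated difference of `middleWeight (m + 2)` and `middleWeight m` below `k`. -/
def weightGap (m k : ℕ) : ℕ :=
  ∑ j ∈ Finset.range k, j.choose 2 * (2 * (m - j) + 1)

/-- The bound on `k` ensures that no subtraction `m - j` in the sum is truncated. -/
theorem weightGap_closed (m : ℕ) : ∀ k, k ≤ m + 1 →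
    (12 * weightGap m k : ℚ) = k * (k - 1) * (k - 2) * (4 * m + 3 - 3 * k)
  | 0, _ => by simp [weightGap]
  | k + 1, hk => by
    have ih := weightGap_closed m k (by omega)
    have e : weightGap m (k + 1) = weightGap m k + k.choose 2 * (2 * (m - k) + 1) :=
      Finset.sum_range_succ _ _
    rw [e]
    push_cast [Nat.cast_choose_two, Nat.cast_sub (show k ≤ m by omega)]
    linear_combination ih

theorem middleWeight_step {m k : ℕ} (hk : k ≤ m) :
    middleWeight (m + 2) k + weightGap m k = middleWeight m k + weightGap m (k + 1) := by
  have e : weightGap m (k + 1) = weightGap m k + k.choose 2 * (2 * (m - k) + 1) :=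
    Finset.sum_range_succ _ _
  obtain ⟨d, rfl⟩ := Nat.exists_eq_add_of_le hk
  rw [e, middleWeight, middleWeight, show k + d + 2 - k = d + 2 by omega, Nat.add_sub_cancel_left]
  have : (d + 2).choose 2 = d.choose 2 + (2 * d + 1) := by
    simp [Nat.choose_succ_succ]; omega
  rw [this]
  ring

/-- Both middle weights contain the factor C(m-k-1,2). Once it is split off, the closed form leaves
a polynomial identity whose last term is visibly nonnegative, and positive for k ≥ 1. -/
theorem weightGap_mul_identity {m k : ℕ} (hk : k + 3 ≤ m) :
    3 * (weightGap m (k + 2) * middleWeight (m + 2) (k + 3) : ℚ) =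
      3 * (weightGap m (k + 3) * middleWeight m (k + 1)) +
      (k + 2).choose 2 * (k * (k + 3) * m * (m - (k + 1) : ℕ).choose 2) := by
  have h1 := weightGap_closed m (k + 2) (by omega)
  have h2 := weightGap_closed m (k + 3) (by omega)
  have e : m + 2 - (k + 3) = m - (k + 1) := by omega
  rw [middleWeight, middleWeight, e]
  push_cast [Nat.cast_choose_two] at *
  generalize ((m - (k + 1) : ℕ) : ℚ) = c at *
  linear_combination (k + 3) * (k + 2) / 8 * (c * (c - 1)) / 2 * h1
    - (k + 1) * k / 8 * (c * (c - 1)) / 2 * h2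

theorem weightGap_mul_le {m k : ℕ} (hk : k + 3 ≤ m) :
    weightGap m (k + 3) * middleWeight m (k + 1) ≤
      weightGap m (k + 2) * middleWeight (m + 2) (k + 3) := by
  have h := weightGap_mul_identity hk
  have h0 : (0 : ℚ) ≤ (k + 2).choose 2 * (k * (k + 3) * m * (m - (k + 1) : ℕ).choose 2) := by
    positivity
  have : ((weightGap m (k + 3) * middleWeight m (k + 1) : ℕ) : ℚ) ≤
      (weightGap m (k + 2) * middleWeight (m + 2) (k + 3) : ℕ) := by
    push_cast; linarith
  exact_mod_cast this

theorem weightGap_mul_lt {m : ℕ} (hm : 4 ≤ m) :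
    weightGap m 4 * middleWeight m 2 < weightGap m 3 * middleWeight (m + 2) 4 := by
  have h := weightGap_mul_identity (m := m) (k := 1) (by omega)
  have hc : 0 < (m - (1 + 1)).choose 2 := Nat.choose_pos (by omega)
  have h0 : (0 : ℚ) < (1 + 2 : ℕ).choose 2 *
      ((1 : ℕ) * ((1 : ℕ) + 3) * m * (m - (1 + 1) : ℕ).choose 2) := by
    have : 0 < (1 + 2 : ℕ).choose 2 := by decide
    positivity
  have : ((weightGap m 4 * middleWeight m 2 : ℕ) : ℚ) <
      (weightGap m 3 * middleWeight (m + 2) 4 : ℕ) := by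
    push_cast
    simp only [Nat.reduceAdd] at h h0
    linarith
  exact_mod_cast this

theorem cast_choose_three (n : ℕ) : (6 * n.choose 3 : ℚ) = n * (n - 1) * (n - 2) := by
  induction n with
  | zero => simp
  | succ n ih =>
    rw [Nat.choose_succ_succ]
    push_cast [Nat.cast_choose_two]
    linear_combination ih

theorem cast_choose_four (n : ℕ) :
    (24 * n.choose 4 : ℚ) = n * (n - 1) * (n - 2) * (n - 3) := by
  induction n with
  | zero => simp
  | succ n ih =>
    rw [Nat.choose_succ_succ]
    push_cast
    linear_combination ih + 4 * cast_choose_three n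

/-- Both sides equal |S⁵(m+2)| - |S⁵(m)| = C(m+3,5) - C(m+1,5). The proof compares closed forms. -/
theorem weightGap_last (m : ℕ) : weightGap m (m + 1) = firstPairWeight (m + 2) := by
  have h := weightGap_closed m (m + 1) le_rfl
  have h1 := cast_choose_four (m + 2)
  have h2 := cast_choose_four (m + 1)
  have : (weightGap m (m + 1) : ℚ) = firstPairWeight (m + 2) := by
    rw [firstPairWeight, show m + 2 - 1 = m + 1 by omega]
    push_cast at *
    linear_combination h / 12 - h1 / 24 - h2 / 24
  exact_mod_cast this

/-! ### The two totals and their recurrences -/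

/-- The weighted number of `l`-element sparse sets of middle coordinates. -/
def sparseTotal (n l : ℕ) : ℕ := sparseSum (middleWeight n) (n + 1) l

/-- The weighted number of `l`-element `2`-sparse sets of first coordinates. -/
def twoSparseTotal : ℕ → ℕ → ℕ
  | _, 0 => 1
  | 0, _ + 1 => 0
  | 1, _ + 1 => 0
  | m + 2, l + 1 => twoSparseTotal m (l + 1) + firstPairWeight (m + 2) * twoSparseTotal m l

theorem twoSparseTotal_zero_right (n : ℕ) : twoSparseTotal n 0 = 1 := by
  rcases n with - | - | n <;> rfl

theorem middleWeight_zero (n : ℕ) : middleWeight n 0 = 0 := by simp [middleWeight]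

theorem middleWeight_one (n : ℕ) : middleWeight n 1 = 0 := by simp [middleWeight]

theorem middleWeight_eq_zero {n k : ℕ} (h : n < k + 2) : middleWeight n k = 0 := by
  rw [middleWeight, Nat.choose_eq_zero_of_lt (show n - k < 2 by omega), mul_zero]

theorem sparseTotal_eq (m l : ℕ) :
    sparseTotal (m + 1) l = sparseSum (middleWeight (m + 1)) m l := by
  rw [sparseTotal, sparseSum_succ_of_eq_zero (middleWeight_eq_zero (by omega)),
    sparseSum_succ_of_eq_zero (middleWeight_eq_zero (by omega))]

theorem sparseTotal_add_two_ge (m l : ℕ) :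
    sparseTotal m (l + 1) + firstPairWeight (m + 2) * sparseTotal m l ≤
      sparseTotal (m + 2) (l + 1) := by
  rcases m with - | m
  · simp [sparseTotal, sparseSum, firstPairWeight, middleWeight, Nat.choose]
  rcases m with - | m
  · simp [sparseTotal, sparseSum, firstPairWeight, middleWeight, Nat.choose]
  have h := sparseSum_comparison (w := middleWeight (m + 4)) (w' := middleWeight (m + 2))
    (p := weightGap (m + 2)) (N := m) (middleWeight_zero _) (middleWeight_one _)
    (middleWeight_zero _) (middleWeight_one _) (by simp [weightGap, Finset.sum_range_succ])
    (fun k hk => middleWeight_step (by omega)) (fun k hk => weightGap_mul_le (by omega))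
    (m + 1) le_rfl l
  -- The top two weights vanish, so each of the three sums is a full total although the segments
  -- have different lengths relative to the weights.
  rwa [show m + 1 + 2 = m + 2 + 1 by omega, weightGap_last, ← sparseTotal_eq (m + 1),
    ← sparseTotal_eq (m + 3), ← sparseTotal] at h

theorem sparseTotal_add_two_gt {m : ℕ} (hm : 4 ≤ m) :
    sparseTotal m 2 + firstPairWeight (m + 2) * sparseTotal m 1 < sparseTotal (m + 2) 2 := by
  obtain ⟨m, rfl⟩ := Nat.exists_eq_add_of_le' hm
  have h := sparseSum_comparison_lt (w := middleWeight (m + 6)) (w' := middleWeight (m + 4))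
    (p := weightGap (m + 4)) (N := m + 2) (middleWeight_zero _) (middleWeight_one _)
    (middleWeight_zero _) (middleWeight_one _) (by simp [weightGap, Finset.sum_range_succ])
    (fun k hk => middleWeight_step (by omega)) (fun k hk => weightGap_mul_le (by omega))
    (weightGap_mul_lt (by omega)) m le_rfl
  rwa [weightGap_last, ← sparseTotal_eq (m + 3), ← sparseTotal_eq (m + 5), ← sparseTotal] at h

theorem sparseTotal_zero_right (n : ℕ) : sparseTotal n 0 = 1 := sparseSum_zero_right _ _

theorem sparseTotal_eq_zero : ∀ {n l : ℕ}, n < 2 * l + 4 → sparseTotal n (l + 1) = 0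
  | 0, _, _ => by simp [sparseTotal, sparseSum, middleWeight]
  | n + 1, l, h => by
    rw [sparseTotal_eq]
    exact sparseSum_eq_zero (middleWeight_zero _) (middleWeight_one _) _ _ (by omega)

theorem twoSparseTotal_eq_zero : ∀ {n l : ℕ}, n < 2 * l + 4 → twoSparseTotal n (l + 1) = 0
  | 0, _, _ => rfl
  | 1, _, _ => rfl
  | m + 2, l, h => by
    rw [twoSparseTotal, twoSparseTotal_eq_zero (n := m) (l := l) (by omega), zero_add]
    rcases l with - | l
    · rw [firstPairWeight, Nat.choose_eq_zero_of_lt (by omega),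
        Nat.choose_eq_zero_of_lt (by omega), zero_add, zero_mul]
    · rw [twoSparseTotal_eq_zero (n := m) (l := l) (by omega), mul_zero]

theorem twoSparseTotal_le_sparseTotal : ∀ n l : ℕ, twoSparseTotal n l ≤ sparseTotal n l
  | n, 0 => by rw [twoSparseTotal_zero_right, sparseTotal_zero_right]
  | 0, _ + 1 => Nat.zero_le _
  | 1, _ + 1 => Nat.zero_le _
  | m + 2, l + 1 =>
    (Nat.add_le_add (twoSparseTotal_le_sparseTotal m (l + 1))
      (Nat.mul_le_mul_left _ (twoSparseTotal_le_sparseTotal m l))).trans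
      (sparseTotal_add_two_ge m l)

theorem twoSparseTotal_lt_sparseTotal {l : ℕ} :
    ∀ {n : ℕ}, 2 * l + 6 ≤ n → twoSparseTotal n (l + 2) < sparseTotal n (l + 2) := by
  induction l with
  | zero =>
    intro n hn
    obtain ⟨m, rfl⟩ := Nat.exists_eq_add_of_le' (show 2 ≤ n by omega)
    exact (Nat.add_le_add (twoSparseTotal_le_sparseTotal m 2)
      (Nat.mul_le_mul_left _ (twoSparseTotal_le_sparseTotal m 1))).trans_lt
      (sparseTotal_add_two_gt (by omega))
  | succ l ih =>
    intro n hn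
    obtain ⟨m, rfl⟩ := Nat.exists_eq_add_of_le' (show 2 ≤ n by omega)
    have hpos : 0 < firstPairWeight (m + 2) :=
      Nat.add_pos_left (Nat.choose_pos (by omega)) _
    exact (Nat.add_lt_add_of_le_of_lt (twoSparseTotal_le_sparseTotal m (l + 3))
      (Nat.mul_lt_mul_of_pos_left (ih (by omega)) hpos)).trans_le
      (sparseTotal_add_two_ge m (l + 2))

/-! ### Counting sets with pairwise related members -/

open Classical in
/-- The number of `l`-element subsets of `U` whose members are pairwise related by `r`. -/
noncomputable def pairwiseCount {α : Type*} (r : α → α → Prop) (U : Finset α) (l : ℕ) : ℕ :=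
  ((U.powersetCard l).filter fun A : Finset α => (A : Set α).Pairwise r).card

theorem pairwiseCount_zero {α : Type*} (r : α → α → Prop) (U : Finset α) :
    pairwiseCount r U 0 = 1 := by
  simp [pairwiseCount, Finset.filter_singleton]

theorem pairwiseCount_empty {α : Type*} (r : α → α → Prop) (l : ℕ) :
    pairwiseCount r ∅ (l + 1) = 0 := by
  rw [pairwiseCount, Finset.powersetCard_eq_empty.2 (by simp)]
  simp

open Classical in
/-- If no two members of `W` are related and the members of `V` that are related to a member
of `W` are always those of `V'`, then a subset of `V ∪ W` with pairwise related members is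
a subset of `V` or consists of one member of `W` and a subset of `V'`. -/
theorem pairwiseCount_union {α : Type*} {r : α → α → Prop} (hr : ∀ x y, r x y → r y x)
    {V W V' : Finset α} (hVW : Disjoint V W) (hV' : V' ⊆ V)
    (hW : ∀ a ∈ W, ∀ b ∈ W, ¬ r a b) (hWV : ∀ a ∈ W, ∀ b ∈ V, r a b ↔ b ∈ V') (l : ℕ) :
    pairwiseCount r (V ∪ W) (l + 1) =
      pairwiseCount r V (l + 1) + W.card * pairwiseCount r V' l := by
  have hsplit : ((V ∪ W).powersetCard (l + 1)).filter (fun A : Finset α => (A : Set α).Pairwise r) =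
      (V.powersetCard (l + 1)).filter (fun A : Finset α => (A : Set α).Pairwise r) ∪
      (W ×ˢ (V'.powersetCard l).filter (fun A : Finset α => (A : Set α).Pairwise r)).image
        (fun q => insert q.1 q.2) := by
    ext A
    simp only [Finset.mem_filter, Finset.mem_powersetCard, Finset.mem_union, Finset.mem_image,
      Finset.mem_product, Prod.exists]
    constructor
    · rintro ⟨⟨hA, hc⟩, hp⟩
      by_cases h : ∃ a ∈ A, a ∈ W
      · obtain ⟨a, ha, haW⟩ := h
        refine Or.inr ⟨a, A.erase a, ⟨haW, ⟨?_, ?_⟩, ?_⟩, Finset.insert_erase ha⟩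
        · intro b hb
          obtain ⟨hba, hbA⟩ := Finset.mem_erase.1 hb
          have hab : r a b := hp ha hbA hba.symm
          rcases Finset.mem_union.1 (hA hbA) with hbV | hbW
          · exact (hWV a haW b hbV).1 hab
          · exact absurd hab (hW a haW b hbW)
        · rw [Finset.card_erase_of_mem ha, hc]; rfl
        · exact hp.mono (by simp)
      · push Not at h
        exact Or.inl ⟨⟨fun b hb => (Finset.mem_union.1 (hA hb)).resolve_right (h b hb), hc⟩, hp⟩
    · rintro (⟨⟨hA, hc⟩, hp⟩ | ⟨a, B, ⟨haW, ⟨hB, hc⟩, hp⟩, rfl⟩)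
      · exact ⟨⟨hA.trans Finset.subset_union_left, hc⟩, hp⟩
      · have haB : a ∉ B := fun h => Finset.disjoint_left.1 hVW (hV' (hB h)) haW
        refine ⟨⟨?_, ?_⟩, ?_⟩
        · intro b hb
          rcases Finset.mem_insert.1 hb with rfl | hb
          · exact Finset.mem_union_right _ haW
          · exact Finset.mem_union_left _ (hV' (hB hb))
        · rw [Finset.card_insert_of_notMem haB, hc]
        · rw [Finset.coe_insert]
          refine hp.insert fun b hb _ => ?_
          have hab : r a b := (hWV a haW b (hV' (hB hb))).2 (hB hb)
          exact ⟨hab, hr _ _ hab⟩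
  have hdisj : Disjoint ((V.powersetCard (l + 1)).filter (fun A : Finset α => (A : Set α).Pairwise r))
      ((W ×ˢ (V'.powersetCard l).filter (fun A : Finset α => (A : Set α).Pairwise r)).image
        (fun q => insert q.1 q.2)) := by
    refine Finset.disjoint_left.2 fun A h1 h2 => ?_
    simp only [Finset.mem_filter, Finset.mem_powersetCard, Finset.mem_image,
      Finset.mem_product, Prod.exists] at h1 h2
    obtain ⟨a, B, ⟨haW, -⟩, rfl⟩ := h2
    exact Finset.disjoint_left.1 hVW (h1.1.1 (Finset.mem_insert_self _ _)) haW
  rw [pairwiseCount, hsplit, Finset.card_union_of_disjoint hdisj, Finset.card_image_of_injOn,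
    Finset.card_product]
  · rfl
  · rintro ⟨a, B⟩ h1 ⟨b, C⟩ h2 h
    simp only [Finset.coe_product, Set.mem_prod, Finset.mem_coe, Finset.mem_filter,
      Finset.mem_powersetCard] at h1 h2 h
    have hnot : ∀ x ∈ W, ∀ D ⊆ V', x ∉ D := fun x hx D hD h' =>
      Finset.disjoint_left.1 hVW (hV' (hD h')) hx
    have haC : a ∉ C := hnot a h1.1 C h2.2.1.1
    have haB : a ∉ B := hnot a h1.1 B h1.2.1.1
    have hbC : b ∉ C := hnot b h2.1 C h2.2.1.1
    have hab : a = b := by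
      have : a ∈ insert b C := h ▸ Finset.mem_insert_self a B
      exact (Finset.mem_insert.1 this).resolve_right haC
    subst hab
    rw [Prod.mk.injEq]
    exact ⟨rfl, by rw [← Finset.erase_insert haB, h, Finset.erase_insert haC]⟩

/-! ### Sparsity as a pairwise relation -/

theorem isSparse_map_iff {α : Type*} (c : α → ℕ) (A : Finset α) :
    IsSparse (A.val.map fun x => (c x : ℤ)) ↔
      (A : Set α).Pairwise fun x y => c x + 2 ≤ c y ∨ c y + 2 ≤ c x := by
  constructor
  · rintro ⟨hd, h⟩ x hx y hy hxy
    have hne : (c x : ℤ) ≠ c y := fun e =>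
      hxy (Multiset.inj_on_of_nodup_map hd x hx y hy e)
    have := h _ (Multiset.mem_map_of_mem _ hx) _ (Multiset.mem_map_of_mem _ hy) hne
    rcases le_abs.1 this with h | h <;> omega
  · intro h
    refine ⟨Multiset.Nodup.map_on ?_ A.nodup, ?_⟩
    · intro x hx y hy e
      by_contra hxy
      have := h hx hy hxy
      omega
    · intro a ha b hb hab
      obtain ⟨x, hx, rfl⟩ := Multiset.mem_map.1 ha
      obtain ⟨y, hy, rfl⟩ := Multiset.mem_map.1 hb
      have hxy : x ≠ y := fun e => hab (by rw [e])
      rcases h hx hy hxy with h | h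
      · exact le_abs.2 (Or.inr (by omega))
      · exact le_abs.2 (Or.inl (by omega))

theorem isTwoSparse_map_iff {α : Type*} (c : α → ℕ) (A : Finset α) :
    IsTwoSparse (A.val.map fun x => (c x : ℤ)) ↔
      (A : Set α).Pairwise fun x y => c x / 2 ≠ c y / 2 := by
  constructor
  · rintro ⟨hd, h⟩ x hx y hy hxy e
    have hne : (c x : ℤ) ≠ c y := fun e =>
      hxy (Multiset.inj_on_of_nodup_map hd x hx y hy e)
    exact h ⟨_, Multiset.mem_map_of_mem _ hx, _, Multiset.mem_map_of_mem _ hy, hne, by omega⟩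
  · intro h
    refine ⟨Multiset.Nodup.map_on ?_ A.nodup, ?_⟩
    · intro x hx y hy e
      by_contra hxy
      exact h hx hy hxy (by omega)
    · rintro ⟨a, ha, b, hb, hab, e⟩
      obtain ⟨x, hx, rfl⟩ := Multiset.mem_map.1 ha
      obtain ⟨y, hy, rfl⟩ := Multiset.mem_map.1 hb
      have hxy : x ≠ y := fun e => hab (by rw [e])
      exact h hx hy hxy (by omega)

theorem countSubsets_sparse (N n l : ℕ) (i : Fin N) :
    countSubsets N n l i IsSparse =
      pairwiseCount (fun x y : Fin N → ℕ => x i + 2 ≤ y i ∨ y i + 2 ≤ x i)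
        (orderSimplex N n) l := by
  rw [countSubsets, pairwiseCount]
  congr 1
  ext A
  simp only [Finset.mem_filter, coordValues, isSparse_map_iff fun x : Fin N → ℕ => x i]

theorem countSubsets_twoSparse (N n l : ℕ) (i : Fin N) :
    countSubsets N n l i IsTwoSparse =
      pairwiseCount (fun x y : Fin N → ℕ => x i / 2 ≠ y i / 2) (orderSimplex N n) l := by
  rw [countSubsets, pairwiseCount]
  congr 1
  ext A
  simp only [Finset.mem_filter, coordValues, isTwoSparse_map_iff fun x : Fin N → ℕ => x i]

theorem pairwiseCount_sparse_lt {α : Type*} (c : α → ℕ) (U : Finset α) :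
    ∀ k l, pairwiseCount (fun x y => c x + 2 ≤ c y ∨ c y + 2 ≤ c x) (U.filter (c · < k)) l =
      sparseSum (fun j => (U.filter (c · = j)).card) k l
  | k, 0 => by rw [pairwiseCount_zero, sparseSum_zero_right]
  | 0, l + 1 => by simp [pairwiseCount_empty, sparseSum]
  | k + 1, l + 1 => by
    classical
    have e : U.filter (c · < k + 1) = U.filter (c · < k) ∪ U.filter (c · = k) := by
      rw [← Finset.filter_or]
      exact Finset.filter_congr fun x _ => by omega
    rw [e, pairwiseCount_union (V' := U.filter (c · < k - 1)) (fun x y h => h.symm)]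
    · rw [pairwiseCount_sparse_lt c U k (l + 1), pairwiseCount_sparse_lt c U (k - 1) l]
      -- For `k = 0` the subtraction `k - 1` truncates harmlessly: `V` and `V'` are both empty. This
      -- matches the separate clause of `sparseSum` at 1.
      rcases k with - | k
      · rcases l with - | l <;> simp [sparseSum]
      · rfl
    · exact Finset.disjoint_filter.2 fun x _ h => by omega
    · exact fun x hx => by
        simp only [Finset.mem_filter] at hx ⊢
        exact ⟨hx.1, by omega⟩
    · intro a ha b hb
      simp only [Finset.mem_filter] at ha hb
      omega
    · intro a ha b hb
      simp only [Finset.mem_filter] at ha hb ⊢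
      constructor
      · exact fun h => ⟨hb.1, by omega⟩
      · exact fun h => by omega

theorem filter_first_ge_eq_empty {α : Type*} {c : α → ℕ} {U : Finset α} {n k : ℕ}
    (hU : ∀ j, (U.filter (c · = j)).card = (n - j).choose 4) (hk : n < k + 4) :
    U.filter (k ≤ c ·) = ∅ := by
  refine Finset.filter_eq_empty_iff.2 fun x hx h => ?_
  have h0 := hU (c x)
  rw [Nat.choose_eq_zero_of_lt (by omega), Finset.card_eq_zero, Finset.filter_eq_empty_iff] at h0
  exact h0 hx rfl

/-- Peel off the lowest block {2j, 2j+1}. Every point above it lies in another block, so here `V' =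
V`, and the remaining fibre sizes are those for `m`. -/
theorem pairwiseCount_twoSparse_ge {α : Type*} (c : α → ℕ) (U : Finset α) {n : ℕ}
    (hU : ∀ j, (U.filter (c · = j)).card = (n - j).choose 4) :
    ∀ m j, m + 2 * j = n → ∀ l,
      pairwiseCount (fun x y => c x / 2 ≠ c y / 2) (U.filter (2 * j ≤ c ·)) l =
        twoSparseTotal m l
  | m, _, _, 0 => by rw [pairwiseCount_zero, twoSparseTotal_zero_right]
  | 0, j, hj, l + 1 => by
    rw [filter_first_ge_eq_empty hU (by omega), pairwiseCount_empty, twoSparseTotal]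
  | 1, j, hj, l + 1 => by
    rw [filter_first_ge_eq_empty hU (by omega), pairwiseCount_empty, twoSparseTotal]
  | m + 2, j, hj, l + 1 => by
    classical
    have e : U.filter (2 * j ≤ c ·) =
        U.filter (2 * (j + 1) ≤ c ·) ∪ (U.filter (c · = 2 * j) ∪ U.filter (c · = 2 * j + 1)) := by
      rw [← Finset.filter_or, ← Finset.filter_or]
      exact Finset.filter_congr fun x _ => by omega
    rw [e, pairwiseCount_union (V' := U.filter (2 * (j + 1) ≤ c ·)) (fun x y h => h.symm)]
    · rw [pairwiseCount_twoSparse_ge c U hU m (j + 1) (by omega),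
        pairwiseCount_twoSparse_ge c U hU m (j + 1) (by omega), Finset.card_union_of_disjoint,
        hU, hU, twoSparseTotal, firstPairWeight, show n - 2 * j = m + 2 by omega,
        show n - (2 * j + 1) = m + 2 - 1 by omega]
      exact Finset.disjoint_filter.2 fun x _ h => by omega
    · rw [← Finset.filter_or]
      exact Finset.disjoint_filter.2 fun x _ h => by omega
    · exact subset_rfl
    · intro a ha b hb
      simp only [Finset.mem_filter, Finset.mem_union] at ha hb
      omega
    · intro a ha b hb
      simp only [Finset.mem_filter, Finset.mem_union] at ha hb ⊢
      constructor
      · exact fun h => hb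
      · exact fun h => by omega

/-! ### Fibres of the simplex over a coordinate -/

/-- A strictly increasing tuple is the increasing enumeration of its image. -/
theorem card_filter_strictMono (m : ℕ) (s : Finset ℕ) :
    ((Fintype.piFinset fun _ : Fin m => s).filter fun x => StrictMono x).card =
      s.card.choose m := by
  classical
  rw [← Finset.card_powersetCard]
  refine Finset.card_bij' (fun x _ => Finset.univ.image x)
    (fun t ht => t.orderEmbOfFin (Finset.mem_powersetCard.1 ht).2) ?_ ?_ ?_ ?_
  · intro x hx
    simp only [Finset.mem_filter, Fintype.mem_piFinset] at hx
    refine Finset.mem_powersetCard.2 ⟨?_, ?_⟩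
    · exact Finset.image_subset_iff.2 fun i _ => hx.1 i
    · rw [Finset.card_image_of_injective _ hx.2.injective, Finset.card_univ, Fintype.card_fin]
  · intro t ht
    simp only [Finset.mem_filter, Fintype.mem_piFinset]
    exact ⟨fun i => (Finset.mem_powersetCard.1 ht).1 (Finset.orderEmbOfFin_mem _ _ i),
      (t.orderEmbOfFin _).strictMono⟩
  · intro x hx
    simp only [Finset.mem_filter, Fintype.mem_piFinset] at hx
    exact (Finset.orderEmbOfFin_unique _ (fun i => Finset.mem_image_of_mem _ (Finset.mem_univ i))
      hx.2).symm
  · intro t ht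
    ext a
    simp

theorem mem_orderSimplex_five {n : ℕ} {x : Fin 5 → ℕ} :
    x ∈ orderSimplex 5 n ↔ x 0 < x 1 ∧ x 1 < x 2 ∧ x 2 < x 3 ∧ x 3 < x 4 ∧ x 4 ≤ n := by
  rw [mem_orderSimplex, Fin.strictMono_iff_lt_succ]
  simp [Fin.forall_fin_succ]
  omega

theorem card_orderSimplex_first (n k : ℕ) :
    ((orderSimplex 5 n).filter fun x => x 0 = k).card = (n - k).choose 4 := by
  rw [← Nat.card_Ioc k n, ← card_filter_strictMono]
  refine Finset.card_bij' (fun x _ => ![x 1, x 2, x 3, x 4])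
    (fun y _ => ![k, y 0, y 1, y 2, y 3]) ?_ ?_ ?_ ?_
  · intro x hx
    rw [Finset.mem_filter, mem_orderSimplex_five] at hx
    rw [Finset.mem_filter, Fintype.mem_piFinset, Fin.strictMono_iff_lt_succ]
    simp [Fin.forall_fin_succ]
    omega
  · intro y hy
    rw [Finset.mem_filter, Fintype.mem_piFinset, Fin.strictMono_iff_lt_succ] at hy
    simp [Fin.forall_fin_succ] at hy
    rw [Finset.mem_filter, mem_orderSimplex_five]
    simp
    omega
  · intro x hx
    obtain rfl := (Finset.mem_filter.1 hx).2
    ext i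
    fin_cases i <;> rfl
  · intro y hy
    ext i
    fin_cases i <;> rfl

theorem card_orderSimplex_middle (n k : ℕ) :
    ((orderSimplex 5 n).filter fun x => x 2 = k).card = middleWeight n k := by
  have h1 := card_filter_strictMono 2 (Finset.range k)
  have h2 := card_filter_strictMono 2 (Finset.Ioc k n)
  rw [Finset.card_range] at h1
  rw [Nat.card_Ioc] at h2
  rw [middleWeight, ← h1, ← h2, ← Finset.card_product]
  refine Finset.card_bij' (fun x _ => (![x 0, x 1], ![x 3, x 4]))
    (fun q _ => ![q.1 0, q.1 1, k, q.2 0, q.2 1]) ?_ ?_ ?_ ?_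
  · intro x hx
    rw [Finset.mem_filter, mem_orderSimplex_five] at hx
    rw [Finset.mem_product, Finset.mem_filter, Finset.mem_filter, Fintype.mem_piFinset,
      Fintype.mem_piFinset, Fin.strictMono_iff_lt_succ, Fin.strictMono_iff_lt_succ]
    simp [Fin.forall_fin_succ]
    omega
  · intro q hq
    rw [Finset.mem_product, Finset.mem_filter, Finset.mem_filter, Fintype.mem_piFinset,
      Fintype.mem_piFinset, Fin.strictMono_iff_lt_succ, Fin.strictMono_iff_lt_succ] at hq
    simp [Fin.forall_fin_succ] at hq
    rw [Finset.mem_filter, mem_orderSimplex_five]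
    simp
    omega
  · intro x hx
    obtain rfl := (Finset.mem_filter.1 hx).2
    ext i
    fin_cases i <;> rfl
  · intro q hq
    refine Prod.ext (funext fun i => ?_) (funext fun i => ?_) <;> fin_cases i <;> rfl

/-! ### The comparison of the two counts -/

theorem mainTheorem3 (n l : ℕ) (hl : 2 ≤ l) (hn : l + 3 ≤ n) :
    countSubsets 5 n l 0 IsTwoSparse ≤ countSubsets 5 n l 2 IsSparse ∧
    (2 * l + 2 ≤ n →
      countSubsets 5 n l 0 IsTwoSparse < countSubsets 5 n l 2 IsSparse) ∧
    (n < 2 * l + 2 →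
      countSubsets 5 n l 0 IsTwoSparse = 0 ∧ countSubsets 5 n l 2 IsSparse = 0) := by
  have h1 : countSubsets 5 n l 0 IsTwoSparse = twoSparseTotal n l := by
    rw [countSubsets_twoSparse, ← pairwiseCount_twoSparse_ge (fun x : Fin 5 → ℕ => x 0)
      (orderSimplex 5 n) (card_orderSimplex_first n) n 0 (by omega)]
    simp
  have h2 : countSubsets 5 n l 2 IsSparse = sparseTotal n l := by
    have := pairwiseCount_sparse_lt (fun x : Fin 5 → ℕ => x 2) (orderSimplex 5 n) (n + 1) l
    rw [Finset.filter_true_of_mem fun x hx =>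
      Nat.lt_succ_of_le ((mem_orderSimplex.1 hx).2 2)] at this
    rw [countSubsets_sparse, this, sparseTotal]
    simp only [card_orderSimplex_middle]
  obtain ⟨l, rfl⟩ := Nat.exists_eq_add_of_le' hl
  rw [h1, h2]
  exact ⟨twoSparseTotal_le_sparseTotal n _,
    fun h => twoSparseTotal_lt_sparseTotal (by omega),
    fun h => ⟨twoSparseTotal_eq_zero (by omega), sparseTotal_eq_zero (by omega)⟩⟩
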